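/- Let $(X,d)$ be a proper geodesic Gromov hyperbolic metric space. Its Gromov boundary $\partial_GX$ is the set of geodesic rays $\gamma:[0,\infty)\to X$ modulo bounded distance, $[\gamma]$ denotes the class of $\gamma$, and $\overline X^G=X\sqcup\partial_GX$ is the Gromov compactification. The horofunction compactification $\overline X^H$ is the closure of $\{[d(x,\cdot)]:x\in X\}$ in $C(X)/\{\text{constants}\}$, where $C(X)$ carries the topology of uniform convergence on compact sets. Assume that $\overline X^H$ and $\overline X^G$ are topologically equivalent, i.e. that there is a homeomorphism $\overline X^H\to\overline X^G$ which is the identity on $X$ (with $x\in X$ identified with $[d(x,\cdot)]$). We use it to identify $\partial_HX=\overline X^H\setminus X$ with $\partial_GX$. For $\zeta\in\partial_GX$, $p\in X$ and $R>0$, let $$E_p(\zeta,R)=\{x\in X: h_{\zeta,p}(x)<\log R\},$$ where $h_{\zeta,p}$ is the unique function in the class of $C(X)/\{\text{constants}\}$ corresponding to $\zeta$ with $h_{\zeta,p}(p)=0$. Let $f:X\to X$ be non-expanding, i.e. $d(f(x),f(y))\le d(x,y)$ for all $x,y\in X$. Let $\eta\in\partial_GX$ and $p\in X$, and define the dilation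 $\lambda_{\eta,p}$ of $f$ at $\eta$ with respect to $p$ by $$\log\lambda_{\eta,p}=\liminf_{z\to\eta}\big(d(z,p)-d(f(z),p)\big),$$ where $z\in X$ tends to $\eta$ in $\overline X^G$. Assume that $\lambda_{\eta,p}<+\infty$. Then there exists a unique $\xi\in\partial_GX$ such that $$f(E_p(\eta,R))\subseteq E_p(\xi,\lambda_{\eta,p}R)\qquad\text{for all }R>0,$$ and, for this $\xi$, the map $f$ has geodesic limit $\xi$ at $\eta$: for every sequence $(x_n)$ in $X$ that converges to $\eta$ in $\overline X^G$ and is contained in $\{x\in X:d(x,\gamma)<M\}$ for some geodesic ray $\gamma$ with $[\gamma]=\eta$ and some $M>0$, the sequence $(f(x_n))$ converges to $\xi$ in $\overline X^G$. -/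

import Mathlib

open Filter Topology
open scoped NNReal ENNReal

/-- A metric space is geodesic if any two of its points are joined by a geodesic segment. -/
def IsGeodesicSpace (X : Type*) [MetricSpace X] : Prop :=
  ∀ x y : X, ∃ c : ℝ → X, c 0 = x ∧ c (dist x y) = y ∧
    ∀ s ∈ Set.Icc 0 (dist x y), ∀ t ∈ Set.Icc 0 (dist x y), dist (c s) (c t) = |s - t|

/-- The Gromov product `(x|y)_w`. -/
noncomputable def gromovProduct {X : Type*} [MetricSpace X] (x y w : X) : ℝ :=
  (dist x w + dist y w - dist x y) / 2

/-- Gromov hyperbolicity: the space is `δ`-hyperbolic for some `δ ≥ 0`. -/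
def IsGromovHyperbolic (X : Type*) [MetricSpace X] : Prop :=
  ∃ δ : ℝ, 0 ≤ δ ∧ ∀ x y z w : X,
    min (gromovProduct x z w) (gromovProduct z y w) - δ ≤ gromovProduct x y w

/-! ### Geodesic rays and the Gromov compactification -/

/-- A geodesic ray is an isometric embedding of `[0, ∞)`. -/
structure GeodesicRay (X : Type*) [MetricSpace X] where
  toFun : ℝ≥0 → X
  isometry : Isometry toFun

/-- Two rays are asymptotic if they stay at bounded distance. -/
def Asymptotic {X : Type*} [MetricSpace X] (γ σ : GeodesicRay X) : Prop :=
  ∃ M : ℝ, ∀ t : ℝ≥0, dist (γ.toFun t) (σ.toFun t) ≤ M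

/-- Being asymptotic is an equivalence relation on geodesic rays. -/
def asymptoticSetoid (X : Type*) [MetricSpace X] : Setoid (GeodesicRay X) where
  r := Asymptotic
  iseqv :=
    { refl := fun γ => ⟨0, fun t => by simp⟩
      symm := fun {γ σ} h => by
        obtain ⟨M, hM⟩ := h
        exact ⟨M, fun t => by rw [dist_comm]; exact hM t⟩
      trans := fun {γ σ τ} h₁ h₂ => by
        obtain ⟨M, hM⟩ := h₁
        obtain ⟨N, hN⟩ := h₂
        exact ⟨M + N, fun t =>
          (dist_triangle _ (σ.toFun t) _).trans (add_le_add (hM t) (hN t))⟩ }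

/-- The Gromov boundary `∂_G X`: geodesic rays up to being asymptotic. -/
def GromovBoundary (X : Type*) [MetricSpace X] : Type _ :=
  Quotient (asymptoticSetoid X)

/-- The endpoint `[γ] ∈ ∂_G X` of a geodesic ray. -/
def GeodesicRay.endpoint {X : Type*} [MetricSpace X] (γ : GeodesicRay X) : GromovBoundary X :=
  Quotient.mk (asymptoticSetoid X) γ

/-- The set `X ⊔ ∂_G X` underlying the Gromov compactification. -/
inductive GromovCompactification (X : Type*) [MetricSpace X] where
  | point : X → GromovCompactification X
  | ideal : GromovBoundary X → GromovCompactification X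

/-- `c` is a geodesic from `p` to the point `z` of `X ⊔ ∂_G X`: if `z ∈ X`, it is a geodesic
segment `[0, T] → X` from `p` to `z` with `T = d(p, z)`, extended to `[0, ∞)` by the constant `z`;
if `z ∈ ∂_G X`, it is a geodesic ray from `p` with endpoint `z`. -/
def IsGeodesicFromTo {X : Type*} [MetricSpace X] (p : X) (c : ℝ≥0 → X) :
    GromovCompactification X → Prop
  | .point x =>
      c 0 = p ∧
      (∀ s t : ℝ≥0, s ≤ nndist p x → t ≤ nndist p x → dist (c s) (c t) = dist s t) ∧
      (∀ t : ℝ≥0, nndist p x ≤ t → c t = x)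
  | .ideal ξ => ∃ γ : GeodesicRay X, γ.toFun = c ∧ c 0 = p ∧ γ.endpoint = ξ

/-- Convergence of a sequence in `X ⊔ ∂_G X` to a point `ξ ∈ ∂_G X`: for geodesics from a base
point `p` to the terms of the sequence, every limit, uniform on compact sets, of a
subsequence of them is a geodesic ray with endpoint `ξ`. (The choices of the base point and of the
geodesics do not matter in a proper geodesic Gromov hyperbolic space.) -/
def GromovTendsto {X : Type*} [MetricSpace X] (u : ℕ → GromovCompactification X)
    (ξ : GromovBoundary X) : Prop :=
  ∃ (p : X) (g : ℕ → ℝ≥0 → X), (∀ n, IsGeodesicFromTo p (g n) (u n)) ∧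
    ∀ (φ : ℕ → ℕ) (c : ℝ≥0 → X), StrictMono φ →
      (∀ K : Set ℝ≥0, IsCompact K → TendstoUniformlyOn (fun k => g (φ k)) c atTop K) →
      ∃ γ : GeodesicRay X, γ.toFun = c ∧ γ.endpoint = ξ

theorem GromovTendsto.comp_strictMono {X : Type*} [MetricSpace X]
    {u : ℕ → GromovCompactification X} {ξ : GromovBoundary X} (h : GromovTendsto u ξ)
    {φ : ℕ → ℕ} (hφ : StrictMono φ) : GromovTendsto (u ∘ φ) ξ := by
  obtain ⟨p, g, hg, hlim⟩ := h
  exact ⟨p, g ∘ φ, fun n => hg (φ n), fun ψ c hψ hc => hlim (φ ∘ ψ) c (hφ.comp hψ) hc⟩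

/-- The topology of the Gromov compactification: a set is closed if its trace on `X` is closed
and it contains the limits in `∂_G X` of all its sequences. -/
instance (X : Type*) [MetricSpace X] : TopologicalSpace (GromovCompactification X) :=
  TopologicalSpace.ofClosed
    {C | IsClosed (GromovCompactification.point ⁻¹' C) ∧
      ∀ (u : ℕ → GromovCompactification X) (ξ : GromovBoundary X),
        (∀ n, u n ∈ C) → GromovTendsto u ξ → GromovCompactification.ideal ξ ∈ C}
    ⟨by simp, fun u _ hu => absurd (hu 0) (Set.notMem_empty _)⟩
    (fun A hA => by
      refine ⟨?_, fun u ξ hu hξ C hC => (hA hC).2 u ξ (fun n => hu n C hC) hξ⟩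
      rw [Set.preimage_sInter]
      exact isClosed_biInter fun C hC => (hA hC).1)
    (fun A hA B hB => by
      refine ⟨by rw [Set.preimage_union]; exact hA.1.union hB.1, fun u ξ hu hξ => ?_⟩
      by_cases hf : ∃ᶠ n in atTop, u n ∈ A
      · obtain ⟨φ, hφ, h⟩ := extraction_of_frequently_atTop hf
        exact Or.inl (hA.2 _ ξ h (hξ.comp_strictMono hφ))
      · have hf' : ∃ᶠ n in atTop, u n ∈ B := by
          rw [not_frequently] at hf
          exact (hf.mono fun n hn => (hu n).resolve_left hn).frequently
        obtain ⟨φ, hφ, h⟩ := extraction_of_frequently_atTop hf'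
        exact Or.inr (hB.2 _ ξ h (hξ.comp_strictMono hφ)))

/-! ### The horofunction compactification -/

/-- `C_*(X)`: continuous real functions, with the topology of uniform convergence on compact
sets, modulo the line of constant functions, with the quotient topology. -/
abbrev FunctionsModConstants (X : Type*) [MetricSpace X] : Type _ :=
  C(X, ℝ) ⧸ Submodule.span ℝ {(1 : C(X, ℝ))}

/-- The class in `C_*(X)` of a continuous function. -/
def classModConstants {X : Type*} [MetricSpace X] (h : C(X, ℝ)) : FunctionsModConstants X :=
  Submodule.Quotient.mk h

/-- The map `i_H : X → C_*(X)`, sending `x` to the class of `y ↦ d(x, y)`. -/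
def distClass {X : Type*} [MetricSpace X] (x : X) : FunctionsModConstants X :=
  classModConstants ⟨fun y => dist x y, by fun_prop⟩

/-- The horofunction compactification: the closure of `i_H(X)` in `C_*(X)`. -/
abbrev HorofunctionCompactification (X : Type*) [MetricSpace X] : Type _ :=
  closure (Set.range (distClass (X := X)))

/-- `i_H`, as a map into the horofunction compactification. -/
def toHorofunctionCompactification {X : Type*} [MetricSpace X] (x : X) :
    HorofunctionCompactification X :=
  ⟨distClass x, subset_closure ⟨x, rfl⟩⟩

/-- The horofunction boundary `∂_H X`. -/
def HorofunctionBoundary (X : Type*) [MetricSpace X] : Set (HorofunctionCompactification X) :=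
  (Set.range (toHorofunctionCompactification (X := X)))ᶜ

/-- The function `h_{a,p}` in the class `a` that vanishes at `p`. -/
noncomputable def horofunction {X : Type*} [MetricSpace X] (a : HorofunctionBoundary X) (p : X) :
    C(X, ℝ) :=
  Quotient.out a.1.1 - ContinuousMap.const X ((Quotient.out a.1.1 : C(X, ℝ)) p)

/-- `h_{a,p}` is indeed the unique function in the class `a` that vanishes at `p`. -/
theorem eq_horofunction_iff {X : Type*} [MetricSpace X] (a : HorofunctionBoundary X) (p : X)
    (h : C(X, ℝ)) : h = horofunction a p ↔ classModConstants h = a.1.1 ∧ h p = 0 := by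
  have key : classModConstants (Quotient.out a.1.1 : C(X, ℝ)) = a.1.1 := Quotient.out_eq a.1.1
  constructor
  · rintro rfl
    refine ⟨?_, by simp [horofunction]⟩
    rw [← key]
    refine (Submodule.Quotient.eq _).2 (Submodule.mem_span_singleton.2
      ⟨-(Quotient.out a.1.1 : C(X, ℝ)) p, ?_⟩)
    ext x
    simp [horofunction]
  · rintro ⟨h1, h2⟩
    rw [← key] at h1
    obtain ⟨c, hc⟩ := Submodule.mem_span_singleton.1 ((Submodule.Quotient.eq _).1 h1)
    have hx : ∀ x, c = h x - (Quotient.out a.1.1 : C(X, ℝ)) x := fun x => by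
      have := congrArg (fun F : C(X, ℝ) => F x) hc
      simpa using this
    ext x
    have e1 := hx x
    have e2 := hx p
    simp only [horofunction, ContinuousMap.sub_apply, ContinuousMap.const_apply]
    linarith

/-- The horosphere `E_p(a, R)`, for `a ∈ ∂_H X`. -/
def horosphere {X : Type*} [MetricSpace X] (p : X) (a : HorofunctionBoundary X) (R : ℝ) : Set X :=
  {x | horofunction a p x < Real.log R}

/-! ### Equivalence of the two compactifications -/

/-- A topological equivalence between the horofunction and the Gromov compactification: a
homeomorphism which is compatible with the embeddings of `X`. -/
structure CompactificationEquiv (X : Type*) [MetricSpace X] where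
  toHomeomorph : HorofunctionCompactification X ≃ₜ GromovCompactification X
  map_point : ∀ x : X, toHomeomorph (toHorofunctionCompactification x) = .point x

/-- The point of `∂_H X` that corresponds to a point of `∂_G X`. -/
def CompactificationEquiv.toHoro {X : Type*} [MetricSpace X] (Φ : CompactificationEquiv X)
    (ξ : GromovBoundary X) : HorofunctionBoundary X :=
  ⟨Φ.toHomeomorph.symm (.ideal ξ), by
    rintro ⟨x, hx⟩
    have h := Φ.map_point x
    rw [hx, Homeomorph.apply_symm_apply] at h
    cases h⟩

/-! ### Dilation and geodesic limits -/

/-- The dilation `λ_{η,p} ∈ [0, ∞]` of `f` at `η` with respect to the base point `p`: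
`log λ_{η,p} = liminf_{z → η} (d(z, p) - d(f(z), p))`, where `z ∈ X` tends to `η` in the Gromov
compactification. -/
noncomputable def dilation {X : Type*} [MetricSpace X] (f : X → X) (η : GromovBoundary X)
    (p : X) : ℝ≥0∞ :=
  EReal.exp (liminf (fun z : X => ((dist z p - dist (f z) p : ℝ) : EReal))
    (comap GromovCompactification.point (𝓝 (GromovCompactification.ideal η))))

/-- The geodesic region `A(γ, R)`. -/
def geodesicRegion {X : Type*} [MetricSpace X] (γ : GeodesicRay X) (R : ℝ) : Set X :=
  {x | Metric.infDist x (Set.range γ.toFun) < R}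

/-- `f : X → Y` has geodesic limit `y` at `η`: along every sequence which converges to `η` and is
contained in a geodesic region with vertex `η`, the map `f` converges to `y`. -/
def HasGeodesicLimit {X Y : Type*} [MetricSpace X] [TopologicalSpace Y] (f : X → Y)
    (η : GromovBoundary X) (y : Y) : Prop :=
  ∀ x : ℕ → X,
    Tendsto (fun n => GromovCompactification.point (x n)) atTop
      (𝓝 (GromovCompactification.ideal η)) →
    (∃ (γ : GeodesicRay X) (R : ℝ), 0 < R ∧ γ.endpoint = η ∧ ∀ n, x n ∈ geodesicRegion γ R) →
    Tendsto (fun n => f (x n)) atTop (𝓝 y)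

/-! Write `l` for the logarithm of the dilation. An ultrafilter tending to `η` realizes the liminf,
so `d(z,p) - d(f z,p) → l` along it. As `d(z,p) → ∞`, also `d(f z,p) → ∞`, hence by compactness `f
z` converges to some ideal point `ξ`. Passing to the limit in `d(f z,f x) - d(f z,p) ≤ (d(z,x) -
d(z,p)) + (d(z,p) - d(f z,p))` gives `h_ξ ∘ f ≤ h_η + l` (`exists_horofunction_comp_le`), which is
the horosphere inclusion in functional form.

Hyperbolicity enters through `gromovTendsto_of_tendsto_horofunction_atBot`: `h_ξ(w_n) → -∞` forces
`w_n → ξ`. In a geodesic region, `x_n → η` implies `h_η(x_n) → -∞` (`horofunction_ray_le`), so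
`h_ξ(f x_n) → -∞` and `f x_n → ξ`. Along a ray to `η` this applies to every admissible `ξ`, and the
Hausdorff property gives uniqueness. -/

section
variable {X : Type*} [MetricSpace X]

/-! ### The topology of the Gromov compactification -/

theorem GromovCompactification.isClosed_iff {C : Set (GromovCompactification X)} :
    IsClosed C ↔ IsClosed (GromovCompactification.point ⁻¹' C) ∧
      ∀ (u : ℕ → GromovCompactification X) (ξ : GromovBoundary X),
        (∀ n, u n ∈ C) → GromovTendsto u ξ → GromovCompactification.ideal ξ ∈ C := by
  rw [← isOpen_compl_iff]
  change Cᶜᶜ ∈ {C : Set (GromovCompactification X) | _} ↔ _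
  rw [compl_compl]
  rfl

theorem GromovTendsto.tendsto {u : ℕ → GromovCompactification X} {ξ : GromovBoundary X}
    (h : GromovTendsto u ξ) : Tendsto u atTop (𝓝 (.ideal ξ)) := by
  rw [tendsto_nhds]
  intro s hs hξ
  by_contra hn
  obtain ⟨φ, hφ, hφs⟩ := extraction_of_frequently_atTop
    (show ∃ᶠ n in atTop, u n ∈ sᶜ from fun h' => hn (by simpa using h'))
  exact (GromovCompactification.isClosed_iff.1 hs.isClosed_compl).2 _ ξ hφs
    (h.comp_strictMono hφ) hξ

theorem GromovCompactification.isOpen_image_point {U : Set X} (hU : IsOpen U) :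
    IsOpen (GromovCompactification.point '' U) := by
  rw [← isClosed_compl_iff, GromovCompactification.isClosed_iff]
  constructor
  · rw [Set.preimage_compl, Set.preimage_image_eq _ fun x y h => by cases h; rfl]
    exact hU.isClosed_compl
  · rintro u ξ - - ⟨x, -, hx⟩
    cases hx

theorem GeodesicRay.dist_eq (γ : GeodesicRay X) (s t : ℝ≥0) :
    dist (γ.toFun s) (γ.toFun t) = |(s : ℝ) - t| := γ.isometry.dist_eq s t

theorem GeodesicRay.gromovTendsto_endpoint (γ : GeodesicRay X) :
    GromovTendsto (fun n : ℕ => .point (γ.toFun n)) γ.endpoint := by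
  have hnn : ∀ n : ℕ, nndist (γ.toFun 0) (γ.toFun n) = n := fun n => by
    rw [γ.isometry.nndist_eq]
    ext
    simp
  refine ⟨γ.toFun 0, fun n t => γ.toFun (min t n), fun n => ⟨by simp, ?_, ?_⟩, ?_⟩
  · intro s t hs ht
    rw [hnn] at hs ht
    simp only [min_eq_left hs, min_eq_left ht]
    exact γ.isometry.dist_eq s t
  · intro t ht
    rw [hnn] at ht
    simp only [min_eq_right ht]
  · intro φ c hφ hc
    refine ⟨γ, funext fun t => ?_, rfl⟩
    refine tendsto_nhds_unique (tendsto_const_nhds.congr' ?_)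
      ((hc {t} isCompact_singleton).tendsto_at (Set.mem_singleton t))
    filter_upwards [eventually_ge_atTop ⌈t⌉₊] with k hk
    have : t ≤ (φ k : ℝ≥0) :=
      (Nat.le_ceil t).trans (by exact_mod_cast hk.trans (hφ.id_le k))
    rw [min_eq_left this]

theorem GeodesicRay.tendsto_endpoint (γ : GeodesicRay X) :
    Tendsto (fun n : ℕ => GromovCompactification.point (γ.toFun n)) atTop
      (𝓝 (.ideal γ.endpoint)) :=
  γ.gromovTendsto_endpoint.tendsto

/-! ### The horofunction compactification -/

/-- The linear functional `[h] ↦ h y - h p` on functions modulo constants. -/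
noncomputable def differenceEval (p y : X) : FunctionsModConstants X →ₗ[ℝ] ℝ :=
  Submodule.liftQ _
    ((ContinuousMap.evalCLM ℝ y - ContinuousMap.evalCLM ℝ p : C(X, ℝ) →L[ℝ] ℝ) : C(X, ℝ) →ₗ[ℝ] ℝ)
    (by
      rw [Submodule.span_singleton_le_iff_mem]
      simp)

@[simp]
theorem differenceEval_classModConstants (p y : X) (h : C(X, ℝ)) :
    differenceEval p y (classModConstants h) = h y - h p := rfl

theorem continuous_differenceEval (p y : X) : Continuous (differenceEval p y) := by
  refine ((Submodule.isOpenQuotientMap_mkQ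
    (Submodule.span ℝ {(1 : C(X, ℝ))})).isQuotientMap.continuous_iff).2 ?_
  change Continuous fun h : C(X, ℝ) => h y - h p
  fun_prop

theorem eq_of_differenceEval_eq {p : X} {a b : FunctionsModConstants X}
    (h : ∀ y, differenceEval p y a = differenceEval p y b) : a = b := by
  obtain ⟨a, rfl⟩ := Submodule.Quotient.mk_surjective _ a
  obtain ⟨b, rfl⟩ := Submodule.Quotient.mk_surjective _ b
  refine (Submodule.Quotient.eq _).2 (Submodule.mem_span_singleton.2 ⟨a p - b p, ?_⟩)
  ext y
  have := h y
  change a y - a p = b y - b p at this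
  simp
  linarith

theorem horofunction_apply (a : HorofunctionBoundary X) (p y : X) :
    horofunction a p y = differenceEval p y a.1.1 := by
  have h := (eq_horofunction_iff a p _).1 rfl
  rw [← h.1, differenceEval_classModConstants, h.2, sub_zero]

instance [Nonempty X] : T2Space (FunctionsModConstants X) :=
  T2Space.of_injective_continuous
    (f := fun (a : FunctionsModConstants X) (y : X) => differenceEval (Classical.arbitrary X) y a)
    (fun _ _ h => eq_of_differenceEval_eq fun y => congrFun h y)
    (continuous_pi fun y => continuous_differenceEval _ y)

theorem continuous_classModConstants :
    Continuous (classModConstants : C(X, ℝ) → FunctionsModConstants X) :=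
  continuous_quot_mk

theorem continuous_distClass : Continuous (distClass : X → FunctionsModConstants X) := by
  refine continuous_classModConstants.comp (ContinuousMap.continuous_of_continuous_uncurry _ ?_)
  change Continuous fun q : X × X => dist q.1 q.2
  fun_prop

theorem isCompact_lipschitz_vanishing (p : X) :
    IsCompact {h : C(X, ℝ) | LipschitzWith 1 h ∧ h p = 0} := by
  refine ArzelaAscoli.isCompact_of_equicontinuous _ ?_ ?_
  · have himage : ContinuousMap.toFun '' {h : C(X, ℝ) | LipschitzWith 1 h ∧ h p = 0} =
        {h : X → ℝ | LipschitzWith 1 h ∧ h p = 0} := by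
      ext h
      constructor
      · rintro ⟨h, hh, rfl⟩
        exact hh
      · rintro hh
        exact ⟨⟨h, hh.1.continuous⟩, hh, rfl⟩
    rw [himage]
    -- Pointwise compactness: a closed subset of a product of intervals, since a 1-Lipschitz
    -- function vanishing at `p` is bounded by `dist y p` at `y`.
    refine (isCompact_univ_pi fun y : X =>
      isCompact_Icc (a := -dist y p) (b := dist y p)).of_isClosed_subset ?_ ?_
    · simp only [lipschitzWith_iff_dist_le_mul, Set.ofPred_and, Set.ofPred_forall]
      refine IsClosed.inter (isClosed_iInter fun x => isClosed_iInter fun y => ?_) ?_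
      · exact isClosed_le (by fun_prop) continuous_const
      · exact isClosed_eq (by fun_prop) continuous_const
    · rintro h ⟨h1, h2⟩ y -
      have := h1.dist_le_mul y p
      rw [h2, Real.dist_eq, sub_zero] at this
      simpa [abs_le] using this
  · refine UniformEquicontinuous.equicontinuous
      (LipschitzWith.uniformEquicontinuous _ 1 fun h => h.2.1)

instance [Nonempty X] : CompactSpace (HorofunctionCompactification X) := by
  rw [← isCompact_iff_compactSpace]
  obtain ⟨p⟩ := ‹Nonempty X›
  have : Nonempty X := ⟨p⟩
  have hK := (isCompact_lipschitz_vanishing p).image continuous_classModConstants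
  refine hK.of_isClosed_subset isClosed_closure (closure_minimal ?_ hK.isClosed)
  rintro - ⟨x, rfl⟩
  -- Normalizing at `p` puts every distance class in the image of one compact set.
  refine ⟨⟨fun y => dist x y - dist x p, by fun_prop⟩, ⟨?_, by simp⟩, ?_⟩
  · refine LipschitzWith.of_dist_le_mul fun y z => ?_
    simp only [ContinuousMap.coe_mk, Real.dist_eq, NNReal.coe_one, one_mul, sub_sub_sub_cancel_right]
    rw [dist_comm x y, dist_comm x z]
    exact abs_dist_sub_le y z x
  · refine eq_of_differenceEval_eq (p := p) fun y => ?_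
    simp [distClass]

/-! ### Convergence to ideal points -/

theorem CompactificationEquiv.tendsto_horofunction (Φ : CompactificationEquiv X) {ι : Type*}
    {l : Filter ι} {u : ι → X} {ξ : GromovBoundary X}
    (h : Tendsto (fun i => GromovCompactification.point (u i)) l (𝓝 (.ideal ξ))) (p y : X) :
    Tendsto (fun i => dist (u i) y - dist (u i) p) l (𝓝 (horofunction (Φ.toHoro ξ) p y)) := by
  rw [horofunction_apply]
  have h' := (continuous_differenceEval p y).continuousAt.tendsto.comp
    (continuous_subtype_val.continuousAt.tendsto.comp
      ((Φ.toHomeomorph.symm.continuous.tendsto _).comp h))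
  refine h'.congr fun i => ?_
  simp only [Function.comp_apply, ← Φ.map_point, Homeomorph.symm_apply_apply]
  rfl

theorem CompactificationEquiv.t2Space (Φ : CompactificationEquiv X) [Nonempty X] :
    T2Space (GromovCompactification X) :=
  Φ.toHomeomorph.t2Space

theorem CompactificationEquiv.compactSpace (Φ : CompactificationEquiv X) [Nonempty X] :
    CompactSpace (GromovCompactification X) :=
  Φ.toHomeomorph.compactSpace

theorem CompactificationEquiv.continuous_point (Φ : CompactificationEquiv X) :
    Continuous (GromovCompactification.point : X → GromovCompactification X) :=
  (Φ.toHomeomorph.continuous.comp (continuous_distClass.subtype_mk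
    fun x => subset_closure (Set.mem_range_self x))).congr fun x => Φ.map_point x

theorem CompactificationEquiv.tendsto_dist_atTop [ProperSpace X] (Φ : CompactificationEquiv X)
    {ι : Type*} {l : Filter ι} {u : ι → X} {ξ : GromovBoundary X}
    (h : Tendsto (fun i => GromovCompactification.point (u i)) l (𝓝 (.ideal ξ))) (p : X) :
    Tendsto (fun i => dist (u i) p) l atTop := by
  have : Nonempty X := ⟨p⟩
  have := Φ.t2Space
  refine tendsto_atTop.2 fun r => ?_
  -- Closed balls are compact, so their images are closed and avoid the ideal points.
  have hK := ((isCompact_closedBall p r).image Φ.continuous_point).isClosed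
  filter_upwards [h.eventually (hK.isOpen_compl.mem_nhds (by rintro ⟨x, -, hx⟩; cases hx))] with i hi
  by_contra hlt
  exact hi ⟨u i, Metric.mem_closedBall.2 (not_le.1 hlt).le, rfl⟩

/-! ### Hyperbolicity and horofunctions -/

/-- Points of `σ` at times `s ≥ t` have product at least `t - D`, so the four-point inequality
bounds `(γ t|σ t)_o` below by `t` minus a constant. Both points lie at distance at most `t` plus a
constant from `o`, hence they are boundedly close. -/
theorem GeodesicRay.asymptotic_of_le_gromovProduct (hhyp : IsGromovHyperbolic X)
    (γ σ : GeodesicRay X) (o : X) (C : ℝ)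
    (h : ∀ t : ℝ≥0, ∃ s ≥ t, t - C ≤ gromovProduct (γ.toFun t) (σ.toFun s) o) :
    Asymptotic γ σ := by
  obtain ⟨δ, hδ, hyp⟩ := hhyp
  set D := dist (σ.toFun 0) o
  set D' := dist (γ.toFun 0) o
  refine ⟨D + D' + 2 * (max C D + δ), fun t => ?_⟩
  obtain ⟨s, hst, hs⟩ := h t
  have hst' : (t : ℝ) ≤ s := by exact_mod_cast hst
  have hσ : ∀ r : ℝ≥0, |dist (σ.toFun r) o - r| ≤ D := fun r => by
    have e := σ.dist_eq r 0
    rw [NNReal.coe_zero, sub_zero, abs_of_nonneg r.coe_nonneg] at e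
    have e1 := dist_triangle (σ.toFun r) (σ.toFun 0) o
    have e2 := dist_triangle_right (σ.toFun r) (σ.toFun 0) o
    rw [abs_le]
    constructor <;> linarith
  have hγ : dist (γ.toFun t) o ≤ t + D' := by
    have e := γ.dist_eq t 0
    rw [NNReal.coe_zero, sub_zero, abs_of_nonneg t.coe_nonneg] at e
    have := dist_triangle (γ.toFun t) (γ.toFun 0) o
    linarith
  have h1 : t - D ≤ gromovProduct (σ.toFun s) (σ.toFun t) o := by
    have e := σ.dist_eq s t
    rw [abs_of_nonneg (by linarith)] at e
    have e1 := abs_le.1 (hσ s)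
    have e2 := abs_le.1 (hσ t)
    unfold gromovProduct
    linarith
  have h2 := hyp (γ.toFun t) (σ.toFun t) (σ.toFun s) o
  have h3 : t - max C D ≤ min (gromovProduct (γ.toFun t) (σ.toFun s) o)
      (gromovProduct (σ.toFun s) (σ.toFun t) o) := by
    refine le_min ?_ ?_
    · linarith [le_max_left C D]
    · linarith [le_max_right C D]
  have h4 := abs_le.1 (hσ t)
  have h5 : t - max C D - δ ≤ gromovProduct (γ.toFun t) (σ.toFun t) o := by linarith
  unfold gromovProduct at h5
  linarith

theorem exists_isGeodesicFromTo (hgeod : IsGeodesicSpace X) (p x : X) :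
    ∃ g : ℝ≥0 → X, IsGeodesicFromTo p g (.point x) := by
  obtain ⟨c, h0, h1, hc⟩ := hgeod p x
  refine ⟨fun t => c (min t (dist p x)), by simp [h0], fun s t hs ht => ?_, fun t ht => ?_⟩
  · have hs' : (s : ℝ) ≤ dist p x := by exact_mod_cast hs
    have ht' : (t : ℝ) ≤ dist p x := by exact_mod_cast ht
    simp only [min_eq_left hs', min_eq_left ht']
    exact hc s ⟨s.2, hs'⟩ t ⟨t.2, ht'⟩
  · have ht' : dist p x ≤ (t : ℝ) := by exact_mod_cast ht
    simp only [min_eq_right ht', h1]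

theorem CompactificationEquiv.neg_dist_le_horofunction (Φ : CompactificationEquiv X)
    (ξ : GromovBoundary X) (p x : X) : -dist x p ≤ horofunction (Φ.toHoro ξ) p x := by
  induction ξ using Quotient.ind with | _ σ =>
  refine ge_of_tendsto' (Φ.tendsto_horofunction σ.tendsto_endpoint p x) fun n => ?_
  linarith [dist_triangle (σ.toFun n) x p]

/-- Since `h_ξ ≥ -d(·,p)`, the points escape to infinity and limits of segments are rays. Once
`h_ξ(w) < -t`, the product of `w` with far points of `σ` exceeds `t`, so the limit ray is asymptotic
to `σ`. -/
theorem CompactificationEquiv.gromovTendsto_of_tendsto_horofunction_atBot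
    (hgeod : IsGeodesicSpace X) (hhyp : IsGromovHyperbolic X) (Φ : CompactificationEquiv X)
    (ξ : GromovBoundary X) (p : X) (w : ℕ → X)
    (hw : Tendsto (fun n => horofunction (Φ.toHoro ξ) p (w n)) atTop atBot) :
    GromovTendsto (fun n => .point (w n)) ξ := by
  induction ξ using Quotient.ind with | _ σ =>
  choose g hg using fun n => exists_isGeodesicFromTo hgeod p (w n)
  refine ⟨p, g, hg, fun φ c hφ hc => ?_⟩
  replace hw := hw.comp hφ.tendsto_atTop
  have hlim : ∀ t, Tendsto (fun k => g (φ k) t) atTop (𝓝 (c t)) := fun t =>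
    (hc {t} isCompact_singleton).tendsto_at (Set.mem_singleton t)
  have hfar : ∀ t : ℝ≥0, ∀ᶠ k in atTop, t ≤ nndist p (w (φ k)) := fun t => by
    filter_upwards [hw.eventually_le_atBot (-(t : ℝ))] with k hk
    have := Φ.neg_dist_le_horofunction (Quotient.mk _ σ) p (w (φ k))
    simp only [Function.comp_apply] at hk
    rw [← NNReal.coe_le_coe, coe_nndist, dist_comm]
    linarith
  have hiso : Isometry c := Isometry.of_dist_eq fun s t => by
    refine tendsto_nhds_unique ((hlim s).dist (hlim t)) (tendsto_const_nhds.congr' ?_)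
    filter_upwards [hfar s, hfar t] with k hs ht
    exact ((hg (φ k)).2.1 s t hs ht).symm
  refine ⟨⟨c, hiso⟩, rfl, Quotient.sound ?_⟩
  have hhyp' := hhyp
  obtain ⟨δ, hδ, hyp⟩ := hhyp
  -- The `1` pays for replacing the segment by its limit `c` at time `t`, the `δ` for one use of
  -- hyperbolicity.
  refine GeodesicRay.asymptotic_of_le_gromovProduct hhyp' _ σ p (1 + δ) fun t => ?_
  obtain ⟨k, hk1, hk2, hk3⟩ := (((hlim t).eventually (Metric.ball_mem_nhds _ one_pos)).and
    ((hfar t).and (hw.eventually_lt_atBot (-(t : ℝ))))).exists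
  simp only [Function.comp_apply] at hk3
  have hs := ((Φ.tendsto_horofunction σ.tendsto_endpoint p (w (φ k))).eventually_lt_const hk3).and
    (eventually_ge_atTop ⌈t⌉₊)
  obtain ⟨s, hs1, hs2⟩ := hs.exists
  refine ⟨s, (Nat.le_ceil t).trans (by exact_mod_cast hs2), ?_⟩
  have hdk : (t : ℝ) ≤ dist p (w (φ k)) := by exact_mod_cast hk2
  have hdk' := dist_comm p (w (φ k))
  have e0 : dist (g (φ k) t) p = t := by
    have := (hg (φ k)).2.1 t 0 hk2 zero_le
    rw [(hg (φ k)).1] at this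
    rw [this, NNReal.dist_eq, NNReal.coe_zero, sub_zero, abs_of_nonneg t.coe_nonneg]
  have e1 : dist (g (φ k) t) (w (φ k)) = dist p (w (φ k)) - t := by
    have := (hg (φ k)).2.1 t (nndist p (w (φ k))) hk2 le_rfl
    rw [(hg (φ k)).2.2 _ le_rfl] at this
    rw [this, NNReal.dist_eq, coe_nndist, abs_sub_comm, abs_of_nonneg (by linarith)]
  have e2 : dist (g (φ k) t) (c t) < 1 := hk1
  have h1 : t - 1 ≤ gromovProduct (c t) (w (φ k)) p := by
    have a1 := dist_triangle_left (c t) (w (φ k)) (g (φ k) t)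
    have a2 := dist_triangle (g (φ k) t) (c t) p
    unfold gromovProduct
    linarith
  have h2 : t - 1 ≤ gromovProduct (w (φ k)) (σ.toFun s) p := by
    rw [dist_comm (σ.toFun s) (w _)] at hs1
    unfold gromovProduct
    linarith
  have := hyp (c t) (σ.toFun s) (w (φ k)) p
  have := le_min h1 h2
  change _ ≤ gromovProduct (c t) _ _
  linarith

theorem CompactificationEquiv.horofunction_ray_le (Φ : CompactificationEquiv X)
    (γ : GeodesicRay X) (p x : X) (t : ℝ≥0) :
    horofunction (Φ.toHoro γ.endpoint) p x ≤ dist x (γ.toFun t) + dist p (γ.toFun 0) - t := by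
  refine le_of_tendsto (Φ.tendsto_horofunction γ.tendsto_endpoint p x) ?_
  filter_upwards [eventually_ge_atTop ⌈t⌉₊] with n hn
  have hn' : (t : ℝ) ≤ n := by exact_mod_cast (Nat.le_ceil t).trans (by exact_mod_cast hn)
  have e1 := γ.dist_eq n t
  have e2 := γ.dist_eq n 0
  simp only [NNReal.coe_natCast, NNReal.coe_zero, sub_zero] at e1 e2
  rw [abs_of_nonneg (by linarith)] at e1
  rw [abs_of_nonneg (by positivity)] at e2
  have := dist_triangle (γ.toFun n) (γ.toFun t) x
  have := dist_triangle (γ.toFun n) p (γ.toFun 0)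
  rw [dist_comm x]
  linarith

end

/-! ### Dilation and horosphere inclusions -/

theorem mapClusterPt_coe_of_liminf_eq {α : Type*} {F : Filter α} {u : α → ℝ} {l : ℝ}
    (h : liminf (fun a => (u a : EReal)) F = l) : MapClusterPt l F u := by
  have hF : MapClusterPt (l : EReal) F fun a => (u a : EReal) := by
    rw [mapClusterPt_iff_frequently]
    intro s hs
    obtain ⟨a, b, ⟨ha, hb⟩, hab⟩ := (mem_nhds_iff_exists_Ioo_subset'
      ⟨⊥, EReal.bot_lt_coe l⟩ ⟨⊤, EReal.coe_lt_top l⟩).1 hs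
    refine ((frequently_lt_of_liminf_lt (by isBoundedDefault) (h.trans_lt hb)).and_eventually
      (eventually_lt_of_lt_liminf (ha.trans_eq h.symm))).mono fun x hx => hab ⟨hx.2, hx.1⟩
  rw [mapClusterPt_iff_ultrafilter] at hF ⊢
  obtain ⟨U, hU, hlim⟩ := hF
  exact ⟨U, hU, EReal.tendsto_coe.1 hlim⟩

section
variable {X : Type*} [MetricSpace X]

theorem exists_liminf_eq_coe_of_dilation_lt_top {f : X → X}
    (hf : ∀ x y : X, dist (f x) (f y) ≤ dist x y) {η : GromovBoundary X} {p : X}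
    (hdil : dilation f η p < ⊤) :
    ∃ l : ℝ, liminf (fun z : X => ((dist z p - dist (f z) p : ℝ) : EReal))
      (comap GromovCompactification.point (𝓝 (.ideal η))) = l ∧
      (dilation f η p).toReal = Real.exp l := by
  unfold dilation at hdil ⊢
  set L := liminf (fun z : X => ((dist z p - dist (f z) p : ℝ) : EReal))
      (comap GromovCompactification.point (𝓝 (.ideal η)))
  have htop : L ≠ ⊤ := (EReal.exp_lt_top_iff.1 hdil).ne
  -- Non-expansion bounds the liminf below, so it is a real number.
  have hbot : ((-dist (f p) p : ℝ) : EReal) ≤ L := by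
    refine le_liminf_of_le (by isBoundedDefault) (Eventually.of_forall fun z => ?_)
    rw [EReal.coe_le_coe_iff]
    linarith [hf z p, dist_triangle (f z) (f p) p]
  have hbot' : L ≠ ⊥ := ((EReal.bot_lt_coe _).trans_le hbot).ne'
  refine ⟨L.toReal, (EReal.coe_toReal htop hbot').symm, ?_⟩
  rw [← EReal.coe_toReal htop hbot', EReal.exp_coe, EReal.toReal_coe,
    ENNReal.toReal_ofReal (Real.exp_pos _).le]

theorem image_horosphere_subset_iff {f : X → X} {p : X} {a b : HorofunctionBoundary X} {l : ℝ} :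
    (∀ R : ℝ, 0 < R → f '' horosphere p a R ⊆ horosphere p b (Real.exp l * R)) ↔
      ∀ x, horofunction b p (f x) ≤ horofunction a p x + l := by
  simp only [horosphere, Set.image_subset_iff]
  constructor
  · refine fun h x => le_of_forall_pos_lt_add fun ε hε => ?_
    -- This radius makes `x` lie just inside the horosphere; then `ε` tends to zero.
    have hR := Real.exp_pos (horofunction a p x + ε)
    have hx : x ∈ {x | horofunction a p x < Real.log (Real.exp (horofunction a p x + ε))} := by
      simp [hε]
    have := h _ hR hx
    rw [← Real.exp_add] at this
    simp only [Set.mem_preimage, Set.mem_ofPred_eq, Real.log_exp] at this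
    linarith
  · intro h R hR x hx
    simp only [Set.mem_preimage, Set.mem_ofPred_eq] at hx ⊢
    rw [Real.log_mul (Real.exp_pos l).ne' hR.ne', Real.log_exp]
    linarith [h x]

/-- The image under a non-expanding map of a filter that realizes the dilation has an ideal
limit point, whose horofunction controls the map. -/
theorem exists_horofunction_comp_le [ProperSpace X] (Φ : CompactificationEquiv X) {f : X → X}
    (hf : ∀ x y : X, dist (f x) (f y) ≤ dist x y) {η : GromovBoundary X} {p : X} {l : ℝ}
    (hl : liminf (fun z : X => ((dist z p - dist (f z) p : ℝ) : EReal))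
      (comap GromovCompactification.point (𝓝 (.ideal η))) = l) :
    ∃ ξ : GromovBoundary X, ∀ x,
      horofunction (Φ.toHoro ξ) p (f x) ≤ horofunction (Φ.toHoro η) p x + l := by
  have : Nonempty X := ⟨p⟩
  have := Φ.compactSpace
  obtain ⟨U, hU, hUl⟩ := mapClusterPt_iff_ultrafilter.1 (mapClusterPt_coe_of_liminf_eq hl)
  have hUη : Tendsto GromovCompactification.point (U : Filter X) (𝓝 (.ideal η)) :=
    tendsto_iff_comap.2 hU
  have hfar : Tendsto (fun z => dist (f z) p) U atTop := by
    refine ((Φ.tendsto_dist_atTop hUη p).atTop_add hUl.neg).congr fun z => ?_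
    ring
  obtain ⟨a, -, ha⟩ := isCompact_univ.ultrafilter_le_nhds
    (U.map fun z => GromovCompactification.point (f z)) (by simp)
  replace ha : Tendsto (fun z => GromovCompactification.point (f z)) (U : Filter X) (𝓝 a) := ha
  cases a with
  | point x =>
    -- A limit in `X` would keep `f z` in a unit ball, against `hfar`.
    exfalso
    obtain ⟨z, ⟨y, hy, hyz⟩, hz⟩ := ((ha.eventually
      ((GromovCompactification.isOpen_image_point (Metric.isOpen_ball (x := x) (ε := 1))).mem_nhds
        ⟨x, Metric.mem_ball_self one_pos, rfl⟩)).and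
      (hfar.eventually_ge_atTop (1 + dist x p))).exists
    cases hyz
    rw [Metric.mem_ball] at hy
    linarith [dist_triangle (f z) x p]
  | ideal ξ =>
    refine ⟨ξ, fun x => le_of_tendsto_of_tendsto' (Φ.tendsto_horofunction ha p (f x))
      ((Φ.tendsto_horofunction hUη p x).add hUl) fun z => ?_⟩
    linarith [hf z x]

end

/-! ### Uniqueness and geodesic limits -/

theorem mainTheorem7 {X : Type*} [MetricSpace X] [ProperSpace X]
    (hgeod : IsGeodesicSpace X) (hhyp : IsGromovHyperbolic X)
    (Φ : CompactificationEquiv X)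
    (f : X → X) (hf : ∀ x y : X, dist (f x) (f y) ≤ dist x y)
    (η : GromovBoundary X) (p : X) (hdil : dilation f η p < ⊤) :
    ∃ ξ : GromovBoundary X,
      ((∀ R : ℝ, 0 < R →
          f '' horosphere p (Φ.toHoro η) R ⊆
            horosphere p (Φ.toHoro ξ) ((dilation f η p).toReal * R)) ∧
        ∀ ξ' : GromovBoundary X,
          (∀ R : ℝ, 0 < R →
            f '' horosphere p (Φ.toHoro η) R ⊆
              horosphere p (Φ.toHoro ξ') ((dilation f η p).toReal * R)) → ξ' = ξ) ∧
      HasGeodesicLimit (fun x => GromovCompactification.point (f x)) η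
        (GromovCompactification.ideal ξ) := by
  have : Nonempty X := ⟨p⟩
  have := Φ.t2Space
  obtain ⟨l, hl, hdl⟩ := exists_liminf_eq_coe_of_dilation_lt_top hf hdil
  obtain ⟨ξ, hξ⟩ := exists_horofunction_comp_le Φ hf hl
  simp only [hdl, image_horosphere_subset_iff]
  have key : ∀ (ξ' : GromovBoundary X) (x : ℕ → X),
      (∀ y, horofunction (Φ.toHoro ξ') p (f y) ≤ horofunction (Φ.toHoro η) p y + l) →
      Tendsto (fun n => horofunction (Φ.toHoro η) p (x n)) atTop atBot →
      Tendsto (fun n => GromovCompactification.point (f (x n))) atTop (𝓝 (.ideal ξ')) :=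
    fun ξ' x h hx => (Φ.gromovTendsto_of_tendsto_horofunction_atBot hgeod hhyp ξ' p _
      (tendsto_atBot_mono (fun n => h (x n)) (tendsto_atBot_add_const_right _ l hx))).tendsto
  refine ⟨ξ, ⟨hξ, fun ξ' hξ' => ?_⟩, fun x hx hreg => ?_⟩
  · induction η using Quotient.ind with | _ γ =>
    have hγ : Tendsto (fun n : ℕ => horofunction (Φ.toHoro γ.endpoint) p (γ.toFun n))
        atTop atBot := by
      refine tendsto_atBot_mono (f := fun n : ℕ => dist p (γ.toFun 0) - (n : ℝ))
        (fun n => ?_) ?_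
      · simpa using Φ.horofunction_ray_le γ p (γ.toFun n) n
      · exact tendsto_const_nhds.add_atBot (tendsto_neg_atTop_atBot.comp
          tendsto_natCast_atTop_atTop)
    have := tendsto_nhds_unique (key ξ' _ hξ' hγ) (key ξ _ hξ hγ)
    cases this
    rfl
  · obtain ⟨γ, R, -, rfl, hγ⟩ := hreg
    refine key ξ x hξ ?_
    have hfar := Φ.tendsto_dist_atTop hx p
    -- A point `γ t` within `R` of `x n` has `t ≥ d(x n,p) - R - d(p,γ 0)`, while `h_η(x n) ≤ R +
    -- d(p,γ 0) - t`; hence the factor 2.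
    refine tendsto_atBot_mono (f := fun n => 2 * (R + dist p (γ.toFun 0)) - dist (x n) p)
      (fun n => ?_) (tendsto_const_nhds.add_atBot (tendsto_neg_atTop_atBot.comp hfar))
    obtain ⟨-, ⟨t, rfl⟩, ht⟩ := (Metric.infDist_lt_iff (Set.range_nonempty _)).1 (hγ n)
    have e := γ.dist_eq t 0
    rw [NNReal.coe_zero, sub_zero, abs_of_nonneg t.coe_nonneg] at e
    have := Φ.horofunction_ray_le γ p (x n) t
    have := dist_triangle4 (x n) (γ.toFun t) (γ.toFun 0) p
    rw [dist_comm (γ.toFun 0) p] at this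
    linarith
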